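/- For $x \in \mathbb R$ let $\|x\|$ be the distance from $x$ to the nearest integer, and let $\varphi$ be Euler's totient function. Let $\alpha$ be an irrational real number that is not Liouville. Let \[ \mu(\alpha) = \sup\{ w > 0 : \|n\alpha\| < n^{-w} \text{ for infinitely many } n \in \mathbb N\} \] be its diophantine exponent, and put $\lambda = 1 + \mu(\alpha)$ and $\varepsilon = \frac{1}{10\lambda}$. For $\gamma \in \mathbb R$ let \[ B = \{ n \in \mathbb N : \|n\alpha - \gamma\| < n^{-4\varepsilon} \} \] and, for $N \in \mathbb N$, \[ T_N(\alpha,\gamma) = \sum_{\substack{1 \le n \le N \\ n \notin B}} \frac{1}{\|n\alpha-\gamma\|}, \qquad T_N^*(\alpha,\gamma) = \sum_{\substack{1 \le n \le N \\ n \notin B}} \frac{\varphi(n)}{n\|n\alpha-\gamma\|}. \] Then there are constants $c, C > 0$ and $N_0 \in \mathbb N$, depending only on $\alpha$, such that for every $\gamma \in \mathbb R$ and every integer $N \ge N_0$, \[ c N\log N \le T_N(\alpha,\gamma) \le C N \log N, \qquad c N\log N \le T_N^*(\alpha,\gamma) \le C N \log N, \] and $c\, T_N^*(\alpha,\gamma)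 \le T_N(\alpha,\gamma) \le C\, T_N^*(\alpha,\gamma)$; that is, $T_N(\alpha,\gamma) \asymp T_N^*(\alpha,\gamma) \asymp N \log N$. In particular $T_N(\alpha,\gamma) \ll N\log N$ and $T^*_N(\alpha,\gamma) \gg N\log N$. -/

import Mathlib

noncomputable section

namespace FracSums

/-- The distance `‖x‖` from a real number `x` to the nearest integer. -/
def distInt (x : ℝ) : ℝ := |x - round x|

/-- The exponents `w > 0` for which `‖n α‖ < n ^ (-w)` for infinitely many positive integers `n`. -/
def exponentSet (α : ℝ) : Set ℝ :=
  {w : ℝ | 0 < w ∧ {n : ℕ | 1 ≤ n ∧ distInt (n * α) < (n : ℝ) ^ (-w)}.Infinite}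

/-- The diophantine exponent `μ(α)`. For `α` irrational and not Liouville the set is nonempty
(it contains `1`, by Dirichlet's theorem) and bounded above, so this is its true supremum. -/
def diophExponent (α : ℝ) : ℝ := sSup (exponentSet α)

/-- `ε = 1 / (10 λ)` with `λ = 1 + μ(α)`. -/
def eps (α : ℝ) : ℝ := 1 / (10 * (1 + diophExponent α))

/-- The set `B` of positive integers `n` with `‖n α - γ‖ < n ^ (-4 ε)`. -/
def badSet (α γ : ℝ) : Set ℕ :=
  {n : ℕ | 1 ≤ n ∧ distInt (n * α - γ) < (n : ℝ) ^ (-(4 * eps α))}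

open Classical in
/-- `T_N(α, γ)`: the sum of `1 / ‖n α - γ‖` over `1 ≤ n ≤ N` with `n ∉ B`. -/
def T (α γ : ℝ) (N : ℕ) : ℝ :=
  ∑ n ∈ (Finset.Icc 1 N).filter (fun n => n ∉ badSet α γ), 1 / distInt (n * α - γ)

open Classical in
/-- `T*_N(α, γ)`: the sum of `φ(n) / (n ‖n α - γ‖)` over `1 ≤ n ≤ N` with `n ∉ B`. -/
def TStar (α γ : ℝ) (N : ℕ) : ℝ :=
  ∑ n ∈ (Finset.Icc 1 N).filter (fun n => n ∉ badSet α γ),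
    (Nat.totient n : ℝ) / (n * distInt (n * α - γ))

end FracSums

end

/-!
Cutting `1 / ‖nα - γ‖` into dyadic pieces reduces both sums to counting, for `δ = 2 ^ (-k)`, the
`n ≤ N` with `‖nα - γ‖ ≤ δ`. Since `α` has finite Diophantine type, Dirichlet's theorem gives `dα`
a rational approximation whose denominator is at most `N / d` and exceeds `10 N ^ (4ε)`, uniformly
in `d ≤ N ^ ε`; rotation by `dα` is thus close to a rational rotation, and the count has its
expected size, also along the multiples of `d`, for every `δ ≥ N ^ (-4ε)`. Outside `B` no smaller
`δ` occurs, which bounds `T` from above. Below, it suffices to use `δ ≥ N ^ (-ε)`: there the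
`O(N ^ (1 - 2ε))` elements of `B` are negligible.

For the weights `φ(n) / n ≥ exp (-2 ∑_{p ∣ n} 1 / p)`, equidistribution along multiples bounds the
average of `∑_{p ∣ n} 1 / p` over the `n` counted, and convexity of `exp` then bounds the average
of `φ(n) / n` below by a positive constant.
-/

namespace FracSums

open Finset Filter Topology

section NearestInteger

theorem distInt_eq_norm (x : ℝ) : distInt x = ‖(x : UnitAddCircle)‖ :=
  UnitAddCircle.norm_eq.symm

theorem distInt_nonneg (x : ℝ) : 0 ≤ distInt x := abs_nonneg _

theorem distInt_le_one (x : ℝ) : distInt x ≤ 1 :=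
  (abs_sub_round x).trans (by norm_num)

theorem distInt_le_abs_sub_intCast (x : ℝ) (m : ℤ) : distInt x ≤ |x - m| := round_le x m

theorem abs_distInt_sub_distInt_le (x y : ℝ) : |distInt x - distInt y| ≤ |x - y| := by
  rw [distInt_eq_norm, distInt_eq_norm]
  refine (abs_norm_sub_norm_le _ _).trans ?_
  rw [← AddCircle.coe_sub, ← distInt_eq_norm]
  simpa using distInt_le_abs_sub_intCast (x - y) 0

theorem distInt_natCast_mul_pos {α : ℝ} (hα : Irrational α) {n : ℕ} (hn : n ≠ 0) :
    0 < distInt (n * α) :=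
  abs_pos.2 (sub_ne_zero.2 fun h => (hα.natCast_mul hn).ne_int _ h)

end NearestInteger

section PeriodicCounting

theorem count_mul_le {P : ℕ → Prop} [DecidablePred P] {q : ℕ} {u : ℝ}
    (h : ∀ a, (Nat.count (fun j => P (a + j)) q : ℝ) ≤ u) (k : ℕ) :
    (Nat.count P (k * q) : ℝ) ≤ k * u := by
  induction k with
  | zero => simp
  | succ k ih =>
    rw [add_one_mul, Nat.count_add]
    push_cast
    linarith [h (k * q)]

theorem le_count_mul {P : ℕ → Prop} [DecidablePred P] {q : ℕ} {u : ℝ}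
    (h : ∀ a, u ≤ (Nat.count (fun j => P (a + j)) q : ℝ)) (k : ℕ) :
    k * u ≤ (Nat.count P (k * q) : ℝ) := by
  induction k with
  | zero => simp
  | succ k ih =>
    rw [add_one_mul, Nat.count_add]
    push_cast
    linarith [h (k * q)]

end PeriodicCounting

section RationalRotation

variable {q : ℕ} [NeZero q]

theorem norm_toAddCircle (r : ZMod q) : ‖ZMod.toAddCircle r‖ = |(r.valMinAbs : ℝ)| / q := by
  have hq : (0 : ℝ) < q := Nat.cast_pos.2 (NeZero.pos q)
  have hr : 2 * |(r.valMinAbs : ℝ)| ≤ q := by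
    have h := Nat.mul_le_of_le_div _ _ _ r.natAbs_valMinAbs_le
    rw [← Int.cast_abs, Int.abs_eq_natAbs]
    exact_mod_cast (mul_comm _ _).trans_le h
  nth_rw 1 [← r.coe_valMinAbs]
  rw [ZMod.toAddCircle_intCast, (AddCircle.norm_coe_eq_abs_iff 1 one_ne_zero).2, abs_div,
    Nat.abs_cast]
  rw [abs_div, Nat.abs_cast, abs_one, div_le_div_iff₀ hq two_pos]
  linarith

theorem card_norm_toAddCircle_le {δ : ℝ} (hδ : 0 ≤ δ) :
    (#{r : ZMod q | ‖ZMod.toAddCircle r‖ ≤ δ} : ℝ) ≤ 2 * δ * q + 1 := by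
  have hq : (0 : ℝ) < q := Nat.cast_pos.2 (NeZero.pos q)
  have hR : 0 ≤ ⌊δ * q⌋ := Int.floor_nonneg.2 (by positivity)
  have hmaps : ∀ r ∈ ({r : ZMod q | ‖ZMod.toAddCircle r‖ ≤ δ} : Finset (ZMod q)),
      r.valMinAbs ∈ Icc (-⌊δ * q⌋) ⌊δ * q⌋ := by
    intro r hr
    rw [mem_filter_univ, norm_toAddCircle, div_le_iff₀ hq, ← Int.cast_abs, ← Int.le_floor] at hr
    rwa [mem_Icc, ← abs_le]
  have hcard := card_le_card_of_injOn _ hmaps ZMod.injective_valMinAbs.injOn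
  rw [Int.card_Icc] at hcard
  have hcard' : (#{r : ZMod q | ‖ZMod.toAddCircle r‖ ≤ δ} : ℤ) ≤ 2 * ⌊δ * q⌋ + 1 := by omega
  have hcard'' : (#{r : ZMod q | ‖ZMod.toAddCircle r‖ ≤ δ} : ℝ) ≤ 2 * ⌊δ * q⌋ + 1 := by
    exact_mod_cast hcard'
  linarith [Int.floor_le (δ * q)]

theorem le_card_norm_toAddCircle {δ : ℝ} (hδ : δ ≤ 1) :
    δ * q ≤ (#{r : ZMod q | ‖ZMod.toAddCircle r‖ ≤ δ} : ℝ) := by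
  have hq : (0 : ℝ) < q := Nat.cast_pos.2 (NeZero.pos q)
  have hmaps : ∀ j ∈ range ⌈δ * q⌉₊,
      (j : ZMod q) ∈ ({r : ZMod q | ‖ZMod.toAddCircle r‖ ≤ δ} : Finset (ZMod q)) := by
    intro j hj
    rw [mem_filter_univ, ZMod.toAddCircle_natCast, ← distInt_eq_norm]
    have hjδ : (j : ℝ) ≤ δ * q := (Nat.lt_ceil.1 (mem_range.1 hj)).le
    calc distInt (j / q) ≤ |(j : ℝ) / q - (0 : ℤ)| := distInt_le_abs_sub_intCast _ 0
      _ = j / q := by rw [Int.cast_zero, sub_zero, abs_of_nonneg (by positivity)]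
      _ ≤ δ := (div_le_iff₀ hq).2 hjδ
  have hlt : ∀ j ∈ range ⌈δ * q⌉₊, j < q := fun j hj =>
    (mem_range.1 hj).trans_le (Nat.ceil_le.2 (mul_le_of_le_one_left hq.le hδ))
  have hinj : Set.InjOn (fun j : ℕ => (j : ZMod q)) (range ⌈δ * q⌉₊) := fun i hi j hj hij => by
    rw [← ZMod.val_cast_of_lt (hlt i hi), ← ZMod.val_cast_of_lt (hlt j hj)]
    exact congrArg ZMod.val hij
  have hcard := card_le_card_of_injOn _ hmaps hinj
  rw [card_range] at hcard
  exact Nat.ceil_le.1 hcard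

theorem count_affine_eq_card (P : ZMod q → Prop) [DecidablePred P] (s : ZMod q) {u : ZMod q}
    (hu : IsUnit u) : Nat.count (fun j => P (j * u - s)) q = #{r | P r} := by
  rw [Nat.count_eq_card_filter_range]
  obtain ⟨u, rfl⟩ := hu
  refine card_nbij' (fun j => j * u - s) (fun r => ((r + s) * ↑u⁻¹).val) ?_ ?_ ?_ ?_
  · intro j hj
    simpa using (mem_filter.1 hj).2
  · intro r hr
    refine mem_filter.2 ⟨mem_range.2 (ZMod.val_lt _), ?_⟩
    simpa using hr
  · intro j hj
    simpa using ZMod.val_cast_of_lt (mem_range.1 (mem_filter.1 hj).1)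
  · intro r _
    simp

end RationalRotation

section Rotation

variable {β γ δ : ℝ} {p : ℤ} {q : ℕ} [NeZero q]

theorem abs_distInt_sub_norm_toAddCircle_le (γ : ℝ) (hβ : |q * β - p| ≤ 1 / q) {j : ℕ}
    (hj : j < q) :
    |distInt (j * β - γ) - ‖ZMod.toAddCircle (j * p - round (q * γ) : ZMod q)‖|
      ≤ 2 / q := by
  have hq : (0 : ℝ) < q := Nat.cast_pos.2 (NeZero.pos q)
  have hcast : (j * p - round (q * γ) : ZMod q) = ((j * p - round (q * γ) : ℤ) : ZMod q) := by
    push_cast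
    rfl
  have hjβ : |(j : ℝ) * (q * β - p)| ≤ 1 := by
    rw [abs_mul, Nat.abs_cast]
    calc (j : ℝ) * |q * β - p| ≤ q * (1 / q) := by gcongr
      _ = 1 := by field_simp
  have hround := abs_sub_round (q * γ)
  rw [hcast, ZMod.toAddCircle_intCast, ← distInt_eq_norm]
  refine (abs_distInt_sub_distInt_le _ _).trans ?_
  calc |j * β - γ - ((j * p - round (q * γ) : ℤ) : ℝ) / q|
      = |j * (q * β - p) - (q * γ - round (q * γ))| / q := by
        rw [← Nat.abs_cast q, ← abs_div, Nat.abs_cast]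
        congr 1
        push_cast
        field_simp
        ring
    _ ≤ 2 / q := by
        gcongr
        linarith [abs_sub ((j : ℝ) * (q * β - p)) (q * γ - round (q * γ))]

theorem count_distInt_le (hpq : IsCoprime p q) (hβ : |q * β - p| ≤ 1 / q) (γ : ℝ) (hδ : 0 ≤ δ) :
    (Nat.count (fun j => distInt (j * β - γ) ≤ δ) q : ℝ) ≤ 2 * δ * q + 5 := by
  have hq : (0 : ℝ) < q := Nat.cast_pos.2 (NeZero.pos q)
  have hle := Nat.count_mono_left (n := q)
    (p := fun j => distInt (j * β - γ) ≤ δ)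
    (q := fun j =>
      ‖ZMod.toAddCircle (j * p - round (q * γ) : ZMod q)‖ ≤ δ + 2 / q)
    fun j hj h => by linarith [(abs_le.1 (abs_distInt_sub_norm_toAddCircle_le γ hβ hj)).1]
  rw [count_affine_eq_card (fun r => ‖ZMod.toAddCircle r‖ ≤ δ + 2 / q) _
    ((ZMod.coe_int_isUnit_iff_isCoprime p q).2 hpq.symm)] at hle
  calc _ ≤ _ := Nat.cast_le.2 hle
    _ ≤ 2 * (δ + 2 / q) * q + 1 := card_norm_toAddCircle_le (by positivity)
    _ = 2 * δ * q + 5 := by field_simp; ring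

theorem le_count_distInt (hpq : IsCoprime p q) (hβ : |q * β - p| ≤ 1 / q) (γ : ℝ) (hδ : δ ≤ 1) :
    δ * q - 2 ≤ (Nat.count (fun j => distInt (j * β - γ) ≤ δ) q : ℝ) := by
  have hq : (0 : ℝ) < q := Nat.cast_pos.2 (NeZero.pos q)
  have hle := Nat.count_mono_left (n := q)
    (p := fun j =>
      ‖ZMod.toAddCircle (j * p - round (q * γ) : ZMod q)‖ ≤ δ - 2 / q)
    (q := fun j => distInt (j * β - γ) ≤ δ)
    fun j hj h => by linarith [(abs_le.1 (abs_distInt_sub_norm_toAddCircle_le γ hβ hj)).2]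
  rw [count_affine_eq_card (fun r => ‖ZMod.toAddCircle r‖ ≤ δ - 2 / q) _
    ((ZMod.coe_int_isUnit_iff_isCoprime p q).2 hpq.symm)] at hle
  calc δ * q - 2 = (δ - 2 / q) * q := by field_simp
    _ ≤ _ := le_card_norm_toAddCircle (by linarith [div_pos two_pos hq])
    _ ≤ _ := Nat.cast_le.2 hle

/-- The times `n ∈ [1, M]` at which the rotation by `β` comes within `δ` of `γ` modulo `1`. -/
noncomputable def hits (β γ δ : ℝ) (M : ℕ) : Finset ℕ :=
  {n ∈ Icc 1 M | distInt (n * β - γ) ≤ δ}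

theorem mem_hits {M n : ℕ} :
    n ∈ hits β γ δ M ↔ (1 ≤ n ∧ n ≤ M) ∧ distInt (n * β - γ) ≤ δ := by
  rw [hits, mem_filter, mem_Icc]

theorem card_hits_eq_count (β γ δ : ℝ) (M : ℕ) :
    #(hits β γ δ M) = Nat.count (fun j => distInt (j * β - (γ - β)) ≤ δ) M := by
  rw [Nat.count_eq_card_filter_range]
  refine card_nbij' (· - 1) (· + 1) ?_ ?_ ?_ ?_
  · intro n hn
    obtain ⟨⟨hn1, hnM⟩, hδ⟩ := mem_hits.1 hn
    refine mem_filter.2 ⟨mem_range.2 (show n - 1 < M by omega), ?_⟩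
    rw [Nat.cast_sub hn1, Nat.cast_one]
    ring_nf at hδ ⊢
    exact hδ
  · intro j hj
    obtain ⟨hjM, hδ⟩ := mem_filter.1 hj
    refine mem_hits.2 ⟨⟨Nat.le_add_left 1 j, mem_range.1 hjM⟩, ?_⟩
    push_cast
    ring_nf at hδ ⊢
    exact hδ
  · intro n hn
    exact Nat.sub_add_cancel (mem_hits.1 hn).1.1
  · intro j _
    exact Nat.add_sub_cancel j 1

theorem card_hits_le (hpq : IsCoprime p q) (hβ : |q * β - p| ≤ 1 / q) (γ : ℝ) (hδ : 0 ≤ δ)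
    {M : ℕ} (hqM : q ≤ M) : (#(hits β γ δ M) : ℝ) ≤ M * (4 * δ + 10 / q) := by
  have hq : (0 : ℝ) < q := Nat.cast_pos.2 (NeZero.pos q)
  have hblock : ∀ a : ℕ, (Nat.count (fun j => distInt ((a + j : ℕ) * β - (γ - β)) ≤ δ) q : ℝ)
      ≤ 2 * δ * q + 5 := fun a => by
    convert count_distInt_le hpq hβ (γ - β - a * β) hδ using 6
    push_cast
    ring
  have hM : M ≤ (M / q + 1) * q := by
    rw [add_one_mul]
    exact (Nat.lt_div_mul_add (NeZero.pos q)).le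
  have hblocks : ((M / q + 1 : ℕ) : ℝ) ≤ 2 * (M / q) := by
    have hdiv : ((M / q : ℕ) : ℝ) ≤ M / q := Nat.cast_div_le
    have hone : (1 : ℝ) ≤ M / q := (one_le_div hq).2 (Nat.cast_le.2 hqM)
    push_cast
    linarith
  rw [card_hits_eq_count]
  calc (Nat.count (fun j => distInt (j * β - (γ - β)) ≤ δ) M : ℝ)
      ≤ Nat.count (fun j => distInt (j * β - (γ - β)) ≤ δ) ((M / q + 1) * q) :=
        Nat.cast_le.2 (Nat.count_monotone _ hM)
    _ ≤ (M / q + 1 : ℕ) * (2 * δ * q + 5) := count_mul_le hblock _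
    _ ≤ 2 * (M / q) * (2 * δ * q + 5) := by gcongr
    _ = M * (4 * δ + 10 / q) := by field_simp; ring

theorem le_card_hits (hpq : IsCoprime p q) (hβ : |q * β - p| ≤ 1 / q) (γ : ℝ) (hδ : δ ≤ 1)
    (hδq : 4 ≤ δ * q) {M : ℕ} (hqM : q ≤ M) : δ * M / 4 ≤ #(hits β γ δ M) := by
  have hq : (0 : ℝ) < q := Nat.cast_pos.2 (NeZero.pos q)
  have hblock : ∀ a : ℕ, δ * q - 2 ≤
      (Nat.count (fun j => distInt ((a + j : ℕ) * β - (γ - β)) ≤ δ) q : ℝ) := fun a => by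
    convert le_count_distInt hpq hβ (γ - β - a * β) hδ using 6
    push_cast
    ring
  have hblocks : (M : ℝ) / q / 2 ≤ (M / q : ℕ) := by
    have hM := Nat.lt_div_mul_add (a := M) (NeZero.pos q)
    have hone : 1 * q ≤ M / q * q := Nat.mul_le_mul_right q (Nat.div_pos hqM (NeZero.pos q))
    have hle : (M : ℝ) ≤ 2 * ((M / q : ℕ) * q) := by
      exact_mod_cast (by omega : M ≤ 2 * (M / q * q))
    rw [div_div, div_le_iff₀ (by positivity)]
    linarith
  rw [card_hits_eq_count]
  calc δ * M / 4 = M / q / 2 * (δ * q / 2) := by field_simp; ring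
    _ ≤ (M / q : ℕ) * (δ * q - 2) := by gcongr; linarith
    _ ≤ Nat.count (fun j => distInt (j * β - (γ - β)) ≤ δ) (M / q * q) := le_count_mul hblock _
    _ ≤ Nat.count (fun j => distInt (j * β - (γ - β)) ≤ δ) M :=
        Nat.cast_le.2 (Nat.count_monotone _ (Nat.div_mul_le_self M q))

theorem card_filter_dvd_hits_le (β γ δ : ℝ) (M : ℕ) {d : ℕ} (hd : 0 < d) :
    #{n ∈ hits β γ δ M | d ∣ n} ≤ #(hits (d * β) γ δ (M / d)) := by
  refine card_le_card_of_injOn (· / d) (fun n hn => ?_) fun m hm n hn hmn => ?_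
  · obtain ⟨hnhits, k, rfl⟩ := mem_filter.1 hn
    obtain ⟨⟨hpos, hle⟩, hδ⟩ := mem_hits.1 hnhits
    simp only [Nat.mul_div_cancel_left k hd]
    refine mem_hits.2 ⟨⟨Nat.pos_of_mul_pos_left hpos, ?_⟩, ?_⟩
    · rwa [Nat.le_div_iff_mul_le hd, mul_comm]
    · push_cast at hδ
      rwa [← mul_assoc, mul_comm (k : ℝ)]
  · exact (Nat.div_left_inj (mem_filter.1 hm).2 (mem_filter.1 hn).2).1 hmn

end Rotation

section DiophantineType

variable {α l : ℝ}

theorem exists_coprime_abs_mul_sub_le (β : ℝ) {M : ℕ} (hM : 0 < M) :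
    ∃ (p : ℤ) (q : ℕ), 0 < q ∧ q ≤ M ∧ IsCoprime p q ∧ |q * β - p| ≤ 1 / (M + 1) := by
  obtain ⟨r, hr, hden⟩ := Real.exists_rat_abs_sub_le_and_den_le β hM
  refine ⟨r.num, r.den, r.den_pos, hden, r.isCoprime_num_den, ?_⟩
  have hmul : (r.den : ℝ) * β - r.num = r.den * (β - r) := by
    rw [mul_sub, mul_comm _ (r : ℝ), ← Rat.cast_natCast, ← Rat.cast_mul, Rat.mul_den_eq_num,
      Rat.cast_intCast]
  rw [hmul, abs_mul, Nat.abs_cast]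
  calc (r.den : ℝ) * |β - r| ≤ r.den * (1 / ((M + 1) * r.den)) := by gcongr
    _ = 1 / (M + 1) := by field_simp

theorem liouvilleWith_of_mem_exponentSet (hα : Irrational α) {w : ℝ} (hw : w ∈ exponentSet α) :
    LiouvilleWith (w + 1) α := by
  refine ⟨1, (Nat.frequently_atTop_iff_infinite.2 hw.2).mono fun n ⟨hn, hlt⟩ =>
    ⟨round (n * α), ?_, ?_⟩⟩
  · exact mod_cast hα.ne_rat (round (n * α) / n)
  · have hn0 : (0 : ℝ) < n := Nat.cast_pos.2 hn
    have hdist : |α - round (n * α) / n| = distInt (n * α) / n := by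
      rw [distInt, ← Nat.abs_cast n, ← abs_div, Nat.abs_cast]
      congr 1
      field_simp
    rw [hdist, Real.rpow_add hn0, Real.rpow_one, ← div_div, one_div, ← Real.rpow_neg hn0.le]
    gcongr

theorem bddAbove_exponentSet (hα : Irrational α) (hL : ¬ Liouville α) :
    BddAbove (exponentSet α) := by
  rw [← forall_liouvilleWith_iff, not_forall] at hL
  obtain ⟨w₀, hw₀⟩ := hL
  refine ⟨w₀, fun w hw => le_of_not_ge fun hle => hw₀ ?_⟩
  exact (liouvilleWith_of_mem_exponentSet hα hw).mono (by linarith)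

theorem diophExponent_nonneg (α : ℝ) : 0 ≤ diophExponent α :=
  Real.sSup_nonneg fun _ hw => hw.1.le

/-- `α` has Diophantine type at most `l`: `‖n α‖` is bounded below by a positive multiple of
`n ^ (-l)` for all `n ≥ 1`. -/
def IsOfType (α l : ℝ) : Prop :=
  ∃ κ > 0, ∀ n : ℕ, n ≠ 0 → κ * (n : ℝ) ^ (-l) ≤ distInt (n * α)

theorem isOfType_of_finite (hα : Irrational α)
    (hfin : {n : ℕ | 1 ≤ n ∧ distInt (n * α) < (n : ℝ) ^ (-l)}.Finite) : IsOfType α l := by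
  have hsmall : ∀ᶠ κ : ℝ in 𝓝[>] 0, ∀ n ∈ {n : ℕ | 1 ≤ n ∧ distInt (n * α) < (n : ℝ) ^ (-l)},
      κ * (n : ℝ) ^ (-l) ≤ distInt (n * α) := by
    refine (eventually_all_finite hfin).2 fun n hn => ?_
    have hlim : Tendsto (fun κ : ℝ => κ * (n : ℝ) ^ (-l)) (𝓝[>] 0) (𝓝 0) := by
      have hcont : Continuous fun κ : ℝ => κ * (n : ℝ) ^ (-l) := by fun_prop
      simpa only [zero_mul] using hcont.continuousWithinAt (s := Set.Ioi 0) (x := 0) |>.tendsto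
    exact hlim.eventually_le_const (distInt_natCast_mul_pos hα (Nat.one_le_iff_ne_zero.1 hn.1))
  obtain ⟨κ, ⟨hκ, hκ0⟩, hκ1⟩ :=
    (hsmall.and self_mem_nhdsWithin |>.and
      (eventually_nhdsWithin_of_eventually_nhds (eventually_le_nhds one_pos))).exists
  refine ⟨κ, hκ0, fun n hn => ?_⟩
  by_cases hlt : distInt (n * α) < (n : ℝ) ^ (-l)
  · exact hκ n ⟨Nat.one_le_iff_ne_zero.2 hn, hlt⟩
  · exact (mul_le_of_le_one_left (by positivity) hκ1).trans (not_lt.1 hlt)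

theorem isOfType_of_diophExponent_lt (hα : Irrational α) (hL : ¬ Liouville α)
    (hl : diophExponent α < l) : IsOfType α l :=
  isOfType_of_finite hα <| Set.not_infinite.1 fun hinf =>
    hl.not_ge <| le_csSup (bddAbove_exponentSet hα hL)
      ⟨(diophExponent_nonneg α).trans_lt hl, hinf⟩

theorem IsOfType.exists_denominator (hα : IsOfType α l) :
    ∃ κ > 0, ∀ N d : ℕ, 0 < d → d ≤ N → ∃ (p : ℤ) (q : ℕ), 0 < q ∧ q ≤ N / d ∧ IsCoprime p q ∧
      |q * (d * α) - p| ≤ 1 / q ∧ κ * N ≤ (q : ℝ) ^ l * (d : ℝ) ^ (l + 1) := by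
  obtain ⟨κ, hκ, hlower⟩ := hα
  refine ⟨κ, hκ, fun N d hd hdN => ?_⟩
  obtain ⟨p, q, hq, hqM, hpq, happrox⟩ := exists_coprime_abs_mul_sub_le (d * α) (Nat.div_pos hdN hd)
  have hq0 : (0 : ℝ) < q := Nat.cast_pos.2 hq
  have hd0 : (0 : ℝ) < d := Nat.cast_pos.2 hd
  have hN0 : (0 : ℝ) < N := Nat.cast_pos.2 (hd.trans_le hdN)
  refine ⟨p, q, hq, hqM, hpq, happrox.trans ?_, ?_⟩
  · have hqM' : (q : ℝ) ≤ (N / d : ℕ) := Nat.cast_le.2 hqM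
    gcongr
    linarith
  · have hlt : (N : ℝ) / d ≤ (N / d : ℕ) + 1 := by
      rw [div_le_iff₀ hd0, add_one_mul]
      exact_mod_cast (Nat.lt_div_mul_add (a := N) hd).le
    have hbounds : κ * ((q : ℝ) * d) ^ (-l) ≤ 1 / (N / d) := by
      calc κ * ((q : ℝ) * d) ^ (-l) ≤ distInt ((q * d : ℕ) * α) := by
            exact_mod_cast hlower (q * d) (by positivity)
        _ ≤ |q * (d * α) - p| := by
            rw [Nat.cast_mul, mul_assoc]
            exact distInt_le_abs_sub_intCast _ p
        _ ≤ 1 / (N / d) := happrox.trans (by gcongr)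
    rw [Real.rpow_neg (by positivity), ← div_eq_mul_inv,
      div_le_div_iff₀ (by positivity) (by positivity), Real.mul_rpow hq0.le hd0.le,
      ← mul_div_assoc, div_le_iff₀ hd0] at hbounds
    rw [Real.rpow_add_one hd0.ne']
    linarith

theorem eventually_forall_rpow_le (hl : 0 < l) {t b κ : ℝ} (htb : t * l + b * (l + 1) < 1)
    (hκ : 0 < κ) : ∀ᶠ N : ℕ in atTop, ∀ d q : ℕ, (d : ℝ) ≤ (N : ℝ) ^ b →
      κ * N ≤ (q : ℝ) ^ l * (d : ℝ) ^ (l + 1) → 10 * (N : ℝ) ^ t ≤ q := by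
  have hlim : Tendsto (fun N : ℕ => (N : ℝ) ^ (1 - (t * l + b * (l + 1)))) atTop atTop :=
    (tendsto_rpow_atTop (sub_pos.2 htb)).comp tendsto_natCast_atTop_atTop
  filter_upwards [hlim.eventually_ge_atTop (10 ^ l / κ), eventually_gt_atTop 0]
    with N hN hN0 d q hd hdq
  have hN0' : (0 : ℝ) < N := Nat.cast_pos.2 hN0
  rw [← Real.rpow_le_rpow_iff (by positivity) (Nat.cast_nonneg q) hl]
  refine le_of_mul_le_mul_right ?_ (Real.rpow_pos_of_pos hN0' (b * (l + 1)))
  calc (10 * (N : ℝ) ^ t) ^ l * (N : ℝ) ^ (b * (l + 1))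
      = 10 ^ l * (N : ℝ) ^ (t * l + b * (l + 1)) := by
        rw [Real.mul_rpow (by norm_num) (by positivity), ← Real.rpow_mul hN0'.le, mul_assoc,
          ← Real.rpow_add hN0']
    _ ≤ κ * (N : ℝ) ^ (1 - (t * l + b * (l + 1))) * (N : ℝ) ^ (t * l + b * (l + 1)) := by
        gcongr
        rwa [mul_comm, ← div_le_iff₀ hκ]
    _ = κ * N := by rw [mul_assoc, ← Real.rpow_add hN0', sub_add_cancel, Real.rpow_one]
    _ ≤ (q : ℝ) ^ l * ((N : ℝ) ^ b) ^ (l + 1) := hdq.trans (by gcongr)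
    _ = (q : ℝ) ^ l * (N : ℝ) ^ (b * (l + 1)) := by rw [← Real.rpow_mul hN0'.le]

theorem IsOfType.eventually_exists_denominator (hα : IsOfType α l) (hl : 0 < l) {t b : ℝ}
    (ht : 0 ≤ t) (htb : t * l + b * (l + 1) < 1) :
    ∀ᶠ N : ℕ in atTop, ∀ d : ℕ, 0 < d → (d : ℝ) ≤ (N : ℝ) ^ b →
      ∃ (p : ℤ) (q : ℕ), 0 < q ∧ q ≤ N / d ∧ IsCoprime p q ∧
        |q * (d * α) - p| ≤ 1 / q ∧ 10 * (N : ℝ) ^ t ≤ q := by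
  obtain ⟨κ, hκ, hdenom⟩ := hα.exists_denominator
  have hb : b ≤ 1 := by nlinarith
  filter_upwards [eventually_forall_rpow_le hl htb hκ, eventually_ge_atTop 1]
    with N hlarge hN d hd hdN
  have hN' : (1 : ℝ) ≤ N := Nat.one_le_cast.2 hN
  have hdN' : d ≤ N := by
    exact_mod_cast hdN.trans (Real.rpow_le_self_of_one_le hN' hb)
  obtain ⟨p, q, hq, hqN, hpq, happrox, hκq⟩ := hdenom N d hd hdN'
  exact ⟨p, q, hq, hqN, hpq, happrox, hlarge d q hdN hκq⟩

theorem ten_le_mul_of_rpow_neg_le {N t δ q : ℝ} (hN : 0 < N) (hδ : N ^ (-t) ≤ δ)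
    (hq : 10 * N ^ t ≤ q) : 10 ≤ δ * q :=
  calc (10 : ℝ) = N ^ (-t) * (10 * N ^ t) := by
        rw [mul_left_comm, ← Real.rpow_add hN, neg_add_cancel, Real.rpow_zero, mul_one]
    _ ≤ δ * q := by
        have hδ0 : 0 ≤ δ := (Real.rpow_nonneg hN.le _).trans hδ
        gcongr

theorem IsOfType.eventually_card_hits_le (hα : IsOfType α l) (hl : 0 < l) {t b : ℝ}
    (ht : 0 ≤ t) (htb : t * l + b * (l + 1) < 1) :
    ∀ᶠ N : ℕ in atTop, ∀ γ δ : ℝ, ∀ d : ℕ, 0 < d → (d : ℝ) ≤ (N : ℝ) ^ b → (N : ℝ) ^ (-t) ≤ δ →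
      (#(hits (d * α) γ δ (N / d)) : ℝ) ≤ 5 * δ * N / d := by
  filter_upwards [hα.eventually_exists_denominator hl ht htb, eventually_gt_atTop 0]
    with N hdenom hN γ δ d hd hdN hδ
  obtain ⟨p, q, hq, hqN, hpq, happrox, hlarge⟩ := hdenom d hd hdN
  have : NeZero q := NeZero.of_pos hq
  have hδq := ten_le_mul_of_rpow_neg_le (Nat.cast_pos.2 hN) hδ hlarge
  have hδ0 : 0 ≤ δ := (Real.rpow_nonneg N.cast_nonneg _).trans hδ
  calc (#(hits (d * α) γ δ (N / d)) : ℝ) ≤ (N / d : ℕ) * (4 * δ + 10 / q) :=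
        card_hits_le hpq happrox γ hδ0 hqN
    _ ≤ N / d * (4 * δ + δ) := by
        gcongr
        · exact Nat.cast_div_le
        · exact (div_le_iff₀ (Nat.cast_pos.2 hq)).2 hδq
    _ = 5 * δ * N / d := by ring

theorem IsOfType.eventually_le_card_hits (hα : IsOfType α l) (hl : 0 < l) {t : ℝ}
    (ht : 0 ≤ t) (htl : t * l < 1) :
    ∀ᶠ N : ℕ in atTop, ∀ γ δ : ℝ, (N : ℝ) ^ (-t) ≤ δ → δ ≤ 1 →
      δ * N / 4 ≤ #(hits α γ δ N) := by
  filter_upwards [hα.eventually_exists_denominator (b := 0) hl ht (by linarith),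
    eventually_gt_atTop 0] with N hdenom hN γ δ hδ hδ1
  obtain ⟨p, q, hq, hqN, hpq, happrox, hlarge⟩ := hdenom 1 one_pos (by simp)
  have : NeZero q := NeZero.of_pos hq
  have hδq := ten_le_mul_of_rpow_neg_le (Nat.cast_pos.2 hN) hδ hlarge
  rw [Nat.div_one] at hqN
  rw [Nat.cast_one, one_mul] at happrox
  exact le_card_hits hpq happrox γ hδ1 (by linarith) hqN

end DiophantineType

section Totient

theorem exp_neg_two_mul_le_one_sub {x : ℝ} (hx0 : 0 ≤ x) (hx : x ≤ 1 / 2) :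
    Real.exp (-(2 * x)) ≤ 1 - x := by
  have hexp := Real.add_one_le_exp (2 * x)
  rw [Real.exp_neg]
  refine (inv_anti₀ (by linarith) hexp).trans ?_
  rw [inv_le_iff_one_le_mul₀ (by linarith)]
  nlinarith

theorem exp_neg_sum_inv_le_totient_div {n : ℕ} (hn : n ≠ 0) :
    Real.exp (-(2 * ∑ p ∈ n.primeFactors, (p : ℝ)⁻¹)) ≤ n.totient / n := by
  have hφ : (n.totient : ℝ) = n * ∏ p ∈ n.primeFactors, (1 - (p : ℝ)⁻¹) := by
    have hφ' := congrArg (Rat.cast : ℚ → ℝ) (Nat.totient_eq_mul_prod_factors n)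
    push_cast at hφ'
    exact hφ'
  rw [hφ, mul_div_cancel_left₀ _ (Nat.cast_ne_zero.2 hn), mul_sum, ← sum_neg_distrib,
    Real.exp_sum]
  refine prod_le_prod (fun _ _ => (Real.exp_pos _).le) fun p hp => ?_
  have hp2 : (2 : ℝ) ≤ p := Nat.ofNat_le_cast.2 (Nat.prime_of_mem_primeFactors hp).two_le
  refine exp_neg_two_mul_le_one_sub (by positivity) ?_
  rw [one_div]
  gcongr

theorem card_primeFactors_mul_log_two_le {n : ℕ} (hn : n ≠ 0) :
    #n.primeFactors * Real.log 2 ≤ Real.log n := by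
  have hpow : 2 ^ #n.primeFactors ≤ n := by
    calc 2 ^ #n.primeFactors ≤ ∏ p ∈ n.primeFactors, p :=
          pow_card_le_prod _ _ _ fun p hp => (Nat.prime_of_mem_primeFactors hp).two_le
      _ ≤ n := Nat.le_of_dvd (Nat.pos_of_ne_zero hn) (Nat.prod_primeFactors_dvd n)
  rw [← Real.log_pow]
  exact Real.log_le_log (by positivity) (by exact_mod_cast hpow)

theorem sum_inv_primeFactors_le {n : ℕ} (hn : n ≠ 0) {y : ℝ} (hy : 0 < y)
    (hlog : Real.log n ≤ y * Real.log 2) :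
    ∑ p ∈ n.primeFactors, (p : ℝ)⁻¹ ≤ ∑ d ∈ Icc 1 ⌊y⌋₊ with d ∣ n, (d : ℝ)⁻¹ + 1 := by
  rw [← sum_filter_add_sum_filter_not n.primeFactors (· ≤ ⌊y⌋₊)]
  gcongr ?_ + ?_
  · refine sum_le_sum_of_subset_of_nonneg (fun p hp => ?_) fun _ _ _ => by positivity
    obtain ⟨hpn, hpy⟩ := mem_filter.1 hp
    exact mem_filter.2 ⟨mem_Icc.2 ⟨(Nat.prime_of_mem_primeFactors hpn).one_le, hpy⟩,
      Nat.dvd_of_mem_primeFactors hpn⟩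
  · -- There are at most `log n / log 2 ≤ y` primes above `y`, each with reciprocal at most `1 / y`.
    have hinv : ∀ p ∈ n.primeFactors.filter (¬ · ≤ ⌊y⌋₊), (p : ℝ)⁻¹ ≤ y⁻¹ := fun p hp =>
      inv_anti₀ hy (Nat.lt_of_floor_lt (not_le.1 (mem_filter.1 hp).2)).le
    have hcard : (#n.primeFactors : ℝ) ≤ y :=
      le_of_mul_le_mul_right ((card_primeFactors_mul_log_two_le hn).trans hlog)
        (Real.log_pos one_lt_two)
    calc ∑ p ∈ n.primeFactors with ¬ p ≤ ⌊y⌋₊, (p : ℝ)⁻¹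
        ≤ #{p ∈ n.primeFactors | ¬ p ≤ ⌊y⌋₊} * y⁻¹ := by
          simpa only [nsmul_eq_mul] using sum_le_card_nsmul _ _ _ hinv
      _ ≤ y * y⁻¹ := by
          gcongr
          exact (Nat.cast_le.2 (card_filter_le _ _)).trans hcard
      _ = 1 := mul_inv_cancel₀ hy.ne'

theorem sum_Icc_inv_sq_le_two (D : ℕ) : ∑ d ∈ Icc 1 D, ((d : ℝ) ^ 2)⁻¹ ≤ 2 := by
  rcases Nat.eq_zero_or_pos D with rfl | hD
  · simp
  · rw [← add_sum_Ioc_eq_sum_Icc hD]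
    have htail := sum_Ioc_inv_sq_le_sub (α := ℝ) one_ne_zero hD
    have hinv : (0 : ℝ) ≤ (D : ℝ)⁻¹ := by positivity
    norm_num at htail ⊢
    linarith

variable {S : Finset ℕ} {y : ℝ}

theorem sum_sum_inv_primeFactors_le {B : ℝ} (hS : ∀ n ∈ S, n ≠ 0) (hy : 1 ≤ y)
    (hlog : ∀ n ∈ S, Real.log n ≤ y * Real.log 2)
    (hdvd : ∀ d : ℕ, 0 < d → (d : ℝ) ≤ y → (#{n ∈ S | d ∣ n} : ℝ) ≤ B / d) :
    ∑ n ∈ S, ∑ p ∈ n.primeFactors, (p : ℝ)⁻¹ ≤ 2 * B + #S := by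
  have hy0 : 0 < y := one_pos.trans_le hy
  have hB : 0 ≤ B := by
    simpa using (Nat.cast_nonneg _).trans (hdvd 1 one_pos (by simpa using hy))
  calc ∑ n ∈ S, ∑ p ∈ n.primeFactors, (p : ℝ)⁻¹
      ≤ ∑ n ∈ S, (∑ d ∈ Icc 1 ⌊y⌋₊ with d ∣ n, (d : ℝ)⁻¹ + 1) :=
        sum_le_sum fun n hn => sum_inv_primeFactors_le (hS n hn) hy0 (hlog n hn)
    _ = ∑ d ∈ Icc 1 ⌊y⌋₊, #{n ∈ S | d ∣ n} * (d : ℝ)⁻¹ + #S := by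
        simp only [sum_add_distrib, sum_filter, sum_const, nsmul_eq_mul, mul_one]
        rw [sum_comm]
        simp only [← sum_filter, sum_const, nsmul_eq_mul]
    _ ≤ ∑ d ∈ Icc 1 ⌊y⌋₊, B * ((d : ℝ) ^ 2)⁻¹ + #S := by
        gcongr ?_ + _
        refine sum_le_sum fun d hd => ?_
        obtain ⟨hd0, hdy⟩ := mem_Icc.1 hd
        rw [pow_two, mul_inv, ← mul_assoc, ← div_eq_mul_inv B]
        gcongr
        exact hdvd d hd0 ((Nat.le_floor_iff hy0.le).1 hdy)
    _ ≤ 2 * B + #S := by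
        rw [← mul_sum, mul_comm 2 B]
        gcongr
        exact sum_Icc_inv_sq_le_two _

theorem exp_neg_mul_card_le_sum_exp_neg {ι : Type*} {s : Finset ι} {f : ι → ℝ} {A : ℝ}
    (hf : ∑ i ∈ s, f i ≤ A * #s) : Real.exp (-A) * #s ≤ ∑ i ∈ s, Real.exp (-f i) := by
  have htangent : ∀ i ∈ s, Real.exp (-A) * (A - f i + 1) ≤ Real.exp (-f i) := fun i _ => by
    rw [show -f i = -A + (A - f i) by ring, Real.exp_add]
    gcongr
    exact Real.add_one_le_exp _
  refine le_trans ?_ (sum_le_sum htangent)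
  rw [← mul_sum]
  gcongr
  simp only [sum_add_distrib, sum_sub_distrib, sum_const, nsmul_eq_mul, mul_one]
  linarith

theorem exp_mul_card_le_sum_totient_div {A : ℝ} (hS : ∀ n ∈ S, n ≠ 0) (hy : 1 ≤ y)
    (hlog : ∀ n ∈ S, Real.log n ≤ y * Real.log 2)
    (hdvd : ∀ d : ℕ, 0 < d → (d : ℝ) ≤ y → (#{n ∈ S | d ∣ n} : ℝ) ≤ A * #S / d) :
    Real.exp (-(4 * A + 2)) * #S ≤ ∑ n ∈ S, (n.totient : ℝ) / n := by
  have hsum := sum_sum_inv_primeFactors_le hS hy hlog hdvd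
  refine (exp_neg_mul_card_le_sum_exp_neg ?_).trans
    (sum_le_sum fun n hn => exp_neg_sum_inv_le_totient_div (hS n hn))
  rw [← mul_sum]
  linarith

end Totient

section DyadicSummation

theorem sum_two_pow_le {x : ℝ} (hx : 0 < x) (K : ℕ) :
    ∑ k ∈ range K with x ≤ (1 / 2) ^ k, (2 : ℝ) ^ k ≤ 2 / x := by
  induction K with
  | zero =>
    rw [range_zero, filter_empty, sum_empty]
    positivity
  | succ K ih =>
    by_cases hxK : x ≤ (1 / 2) ^ K
    · calc ∑ k ∈ range (K + 1) with x ≤ (1 / 2) ^ k, (2 : ℝ) ^ k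
          ≤ ∑ k ∈ range (K + 1), (2 : ℝ) ^ k :=
            sum_le_sum_of_subset_of_nonneg (filter_subset _ _) fun _ _ _ => by positivity
        _ ≤ 2 * 2 ^ K := by
            rw [geom_sum_eq (by norm_num), pow_succ]
            norm_num
            linarith
        _ ≤ 2 / x := by
            rw [one_div, inv_pow] at hxK
            rw [div_eq_mul_inv]
            gcongr
            exact (le_inv_comm₀ hx (by positivity)).1 hxK
    · rwa [range_add_one, filter_insert, if_neg hxK]

theorem one_div_le_two_mul_sum_two_pow {x : ℝ} (hx0 : 0 < x) (hx1 : x ≤ 1) {K : ℕ}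
    (hK : (1 / 2) ^ K < x) : 1 / x ≤ 2 * ∑ k ∈ range K with x ≤ (1 / 2) ^ k, (2 : ℝ) ^ k := by
  induction K with
  | zero => exact absurd hK (by simpa using hx1)
  | succ K ih =>
    by_cases hxK : x ≤ (1 / 2) ^ K
    · calc 1 / x ≤ 2 * 2 ^ K := by
            rw [one_div, inv_pow] at hK
            rw [one_div, ← pow_succ']
            exact (inv_le_comm₀ (by positivity) hx0).1 hK.le
        _ ≤ 2 * ∑ k ∈ range (K + 1) with x ≤ (1 / 2) ^ k, (2 : ℝ) ^ k := by
            gcongr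
            exact single_le_sum (f := fun k => (2 : ℝ) ^ k) (fun _ _ => by positivity)
              (mem_filter.2 ⟨self_mem_range_succ K, hxK⟩)
    · rw [range_add_one, filter_insert, if_neg hxK]
      exact ih (not_le.1 hxK)

theorem exists_dyadic_length {η : ℝ} (hη0 : 0 < η) (hη1 : η ≤ 1) :
    ∃ K : ℕ, (1 / 2) ^ K < η ∧ (∀ k < K, η ≤ (1 / 2) ^ k) ∧
      Real.log η⁻¹ ≤ K ∧ (K : ℝ) ≤ 1 + 2 * Real.log η⁻¹ := by
  obtain ⟨n, hle, hlt⟩ := exists_nat_pow_near ((one_le_inv₀ hη0).2 hη1) one_lt_two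
  have hlogle := Real.log_le_log (by positivity) hle
  have hloglt := Real.log_le_log (by positivity) hlt.le
  rw [Real.log_pow] at hlogle hloglt
  have hlog2 : Real.log 2 ≤ 1 := by linarith [Real.log_two_lt_d9]
  have hlog2' : 1 / 2 ≤ Real.log 2 := by linarith [Real.log_two_gt_d9]
  refine ⟨n + 1, ?_, fun k hk => ?_, ?_, ?_⟩
  · rw [one_div, inv_pow]
    exact inv_lt_of_inv_lt₀ hη0 hlt
  · rw [one_div, inv_pow, le_inv_comm₀ hη0 (by positivity)]
    exact (pow_le_pow_right₀ one_le_two (Nat.lt_succ_iff.1 hk)).trans hle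
  · exact hloglt.trans (mul_le_of_le_one_right (by positivity) hlog2)
  · have hhalf : (n : ℝ) * (1 / 2) ≤ n * Real.log 2 := by gcongr
    push_cast
    linarith

variable {ι : Type*} {s : Finset ι} {w d : ι → ℝ} {η : ℝ}

theorem sum_mul_sum_two_pow_eq (s : Finset ι) (w d : ι → ℝ) (K : ℕ) :
    ∑ i ∈ s, w i * ∑ k ∈ range K with d i ≤ (1 / 2) ^ k, (2 : ℝ) ^ k =
      ∑ k ∈ range K, 2 ^ k * ∑ i ∈ s with d i ≤ (1 / 2) ^ k, w i := by
  simp only [mul_sum, sum_filter]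
  rw [sum_comm]
  simp only [mul_ite, mul_zero, mul_comm]
  simp only [zero_mul]

theorem sum_div_le_of_sum_filter_le {A : ℝ} (hη0 : 0 < η) (hη1 : η ≤ 1)
    (hw : ∀ i ∈ s, 0 ≤ w i) (hηd : ∀ i ∈ s, η ≤ d i) (hd1 : ∀ i ∈ s, d i ≤ 1)
    (hA : ∀ δ, η ≤ δ → δ ≤ 1 → ∑ i ∈ s with d i ≤ δ, w i ≤ A * δ) :
    ∑ i ∈ s, w i / d i ≤ 2 * A * (1 + 2 * Real.log η⁻¹) := by
  obtain ⟨K, hKη, hK, -, hKlog⟩ := exists_dyadic_length hη0 hη1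
  have hA0 : 0 ≤ A := by
    simpa only [mul_one] using
      (sum_nonneg fun i hi => hw i (mem_filter.1 hi).1).trans (hA 1 hη1 le_rfl)
  calc ∑ i ∈ s, w i / d i
      ≤ ∑ i ∈ s, w i * (2 * ∑ k ∈ range K with d i ≤ (1 / 2) ^ k, (2 : ℝ) ^ k) := by
        refine sum_le_sum fun i hi => ?_
        rw [div_eq_mul_one_div]
        exact mul_le_mul_of_nonneg_left (one_div_le_two_mul_sum_two_pow
          (hη0.trans_le (hηd i hi)) (hd1 i hi) (hKη.trans_le (hηd i hi))) (hw i hi)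
    _ = 2 * ∑ k ∈ range K, 2 ^ k * ∑ i ∈ s with d i ≤ (1 / 2) ^ k, w i := by
        rw [← sum_mul_sum_two_pow_eq, mul_sum]
        simp only [mul_left_comm]
    _ ≤ 2 * ∑ k ∈ range K, 2 ^ k * (A * (1 / 2) ^ k) := by
        gcongr with k hk
        exact hA _ (hK k (mem_range.1 hk)) (pow_le_one₀ (by norm_num) (by norm_num))
    _ = 2 * A * K := by
        simp only [mul_left_comm _ A, ← mul_pow]
        norm_num
        ring
    _ ≤ 2 * A * (1 + 2 * Real.log η⁻¹) := by gcongr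

theorem le_sum_div_of_le_sum_filter {B : ℝ} (hη0 : 0 < η) (hη1 : η ≤ 1)
    (hw : ∀ i ∈ s, 0 ≤ w i) (hd : ∀ i ∈ s, 0 < d i) (hB0 : 0 ≤ B)
    (hB : ∀ δ, η ≤ δ → δ ≤ 1 → B * δ ≤ ∑ i ∈ s with d i ≤ δ, w i) :
    B / 2 * Real.log η⁻¹ ≤ ∑ i ∈ s, w i / d i := by
  obtain ⟨K, -, hK, hlogK, -⟩ := exists_dyadic_length hη0 hη1
  calc B / 2 * Real.log η⁻¹ ≤ B / 2 * K := by gcongr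
    _ = 1 / 2 * ∑ k ∈ range K, 2 ^ k * (B * (1 / 2) ^ k) := by
        simp only [mul_left_comm _ B, ← mul_pow]
        norm_num
        ring
    _ ≤ 1 / 2 * ∑ k ∈ range K, 2 ^ k * ∑ i ∈ s with d i ≤ (1 / 2) ^ k, w i := by
        gcongr with k hk
        exact hB _ (hK k (mem_range.1 hk)) (pow_le_one₀ (by norm_num) (by norm_num))
    _ = ∑ i ∈ s, w i * (1 / 2 * ∑ k ∈ range K with d i ≤ (1 / 2) ^ k, (2 : ℝ) ^ k) := by
        rw [← sum_mul_sum_two_pow_eq, mul_sum]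
        simp only [mul_left_comm]
    _ ≤ ∑ i ∈ s, w i / d i := by
        refine sum_le_sum fun i hi => ?_
        rw [div_eq_mul_inv]
        refine mul_le_mul_of_nonneg_left ?_ (hw i hi)
        linarith [sum_two_pow_le (hd i hi) K, div_eq_mul_inv 2 (d i)]

end DyadicSummation

section GoodSet

variable {α γ δ : ℝ} {N n : ℕ}

theorem eps_pos (α : ℝ) : 0 < eps α := by
  have := diophExponent_nonneg α
  unfold eps
  positivity

theorem eps_le (α : ℝ) : eps α ≤ 1 / 10 := by
  have := diophExponent_nonneg α
  unfold eps
  gcongr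
  linarith

theorem eps_mul_one_add_diophExponent (α : ℝ) : eps α * (1 + diophExponent α) = 1 / 10 := by
  have := diophExponent_nonneg α
  unfold eps
  field_simp

open Classical in
/-- The `n ∈ [1, N]` outside the bad set: the range of summation of `T` and `TStar`. -/
noncomputable def goodSet (α γ : ℝ) (N : ℕ) : Finset ℕ :=
  {n ∈ Icc 1 N | n ∉ badSet α γ}

theorem mem_goodSet : n ∈ goodSet α γ N ↔ (1 ≤ n ∧ n ≤ N) ∧ n ∉ badSet α γ := by
  simp only [goodSet, mem_filter, mem_Icc]

theorem rpow_neg_le_distInt_of_mem_goodSet (hn : n ∈ goodSet α γ N) :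
    (N : ℝ) ^ (-(4 * eps α)) ≤ distInt (n * α - γ) := by
  obtain ⟨⟨hn1, hnN⟩, hbad⟩ := mem_goodSet.1 hn
  calc (N : ℝ) ^ (-(4 * eps α)) ≤ (n : ℝ) ^ (-(4 * eps α)) :=
        Real.rpow_le_rpow_of_nonpos (Nat.cast_pos.2 hn1) (Nat.cast_le.2 hnN)
          (by linarith [eps_pos α])
    _ ≤ distInt (n * α - γ) := not_lt.1 fun hlt => hbad ⟨hn1, hlt⟩

theorem distInt_pos_of_mem_goodSet (hn : n ∈ goodSet α γ N) : 0 < distInt (n * α - γ) := by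
  obtain ⟨⟨hn1, hnN⟩, -⟩ := mem_goodSet.1 hn
  exact (Real.rpow_pos_of_pos (Nat.cast_pos.2 (hn1.trans hnN)) _).trans_le
    (rpow_neg_le_distInt_of_mem_goodSet hn)

theorem filter_goodSet_subset_hits (α γ δ : ℝ) (N : ℕ) :
    {n ∈ goodSet α γ N | distInt ((n : ℕ) * α - γ) ≤ δ} ⊆ hits α γ δ N := fun _ hn =>
  mem_hits.2 ⟨(mem_goodSet.1 (mem_filter.1 hn).1).1, (mem_filter.1 hn).2⟩

theorem card_hits_le_card_filter_goodSet_add (α γ δ : ℝ) (N : ℕ) :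
    #(hits α γ δ N) ≤ #{n ∈ goodSet α γ N | distInt ((n : ℕ) * α - γ) ≤ δ} +
      #(Icc 1 N \ goodSet α γ N) := by
  refine (card_le_card fun n hn => ?_).trans (card_union_le _ _)
  obtain ⟨hnN, hδ⟩ := mem_hits.1 hn
  by_cases hgood : n ∈ goodSet α γ N
  · exact mem_union_left _ (mem_filter.2 ⟨hgood, hδ⟩)
  · exact mem_union_right _ (mem_sdiff.2 ⟨mem_Icc.2 hnN, hgood⟩)

theorem card_Icc_sdiff_goodSet_le (hN : 0 < N) :
    (#(Icc 1 N \ goodSet α γ N) : ℝ) ≤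
      (N : ℝ) ^ (1 / 2 : ℝ) + #(hits α γ ((N : ℝ) ^ (-(2 * eps α))) N) := by
  have hsqrt : (0 : ℝ) < (N : ℝ) ^ (1 / 2 : ℝ) := Real.rpow_pos_of_pos (Nat.cast_pos.2 hN) _
  have hsub : Icc 1 N \ goodSet α γ N ⊆
      Icc 1 ⌊(N : ℝ) ^ (1 / 2 : ℝ)⌋₊ ∪ hits α γ ((N : ℝ) ^ (-(2 * eps α))) N := by
    intro n hn
    obtain ⟨hnN, hgood⟩ := mem_sdiff.1 hn
    rw [mem_Icc] at hnN
    by_cases hsmall : (n : ℝ) ≤ (N : ℝ) ^ (1 / 2 : ℝ)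
    · exact mem_union_left _ (mem_Icc.2 ⟨hnN.1, Nat.le_floor hsmall⟩)
    · have hbad : n ∈ badSet α γ := not_not.1 fun hbad => hgood (mem_goodSet.2 ⟨hnN, hbad⟩)
      refine mem_union_right _ (mem_hits.2 ⟨hnN, hbad.2.le.trans ?_⟩)
      calc (n : ℝ) ^ (-(4 * eps α)) ≤ ((N : ℝ) ^ (1 / 2 : ℝ)) ^ (-(4 * eps α)) :=
            Real.rpow_le_rpow_of_nonpos hsqrt (not_le.1 hsmall).le (by linarith [eps_pos α])
        _ = (N : ℝ) ^ (-(2 * eps α)) := by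
            rw [← Real.rpow_mul N.cast_nonneg]
            ring_nf
  have hcard := (card_le_card hsub).trans (card_union_le _ _)
  rw [Nat.card_Icc, Nat.add_sub_cancel] at hcard
  calc (#(Icc 1 N \ goodSet α γ N) : ℝ)
      ≤ ⌊(N : ℝ) ^ (1 / 2 : ℝ)⌋₊ + #(hits α γ ((N : ℝ) ^ (-(2 * eps α))) N) := by
        exact_mod_cast hcard
    _ ≤ (N : ℝ) ^ (1 / 2 : ℝ) + #(hits α γ ((N : ℝ) ^ (-(2 * eps α))) N) := by
        gcongr
        exact Nat.floor_le hsqrt.le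

theorem TStar_le_T (α γ : ℝ) (N : ℕ) : TStar α γ N ≤ T α γ N := by
  refine sum_le_sum fun n _ => ?_
  rw [← div_div]
  gcongr
  · exact distInt_nonneg _
  · exact div_le_one_of_le₀ (Nat.cast_le.2 n.totient_le) n.cast_nonneg

end GoodSet

section Asymptotics

variable {α : ℝ}

theorem eventually_card_hits_le (hα : Irrational α) (hL : ¬ Liouville α) :
    ∀ᶠ N : ℕ in atTop, ∀ γ δ : ℝ, ∀ d : ℕ, 0 < d → (d : ℝ) ≤ (N : ℝ) ^ eps α →
      (N : ℝ) ^ (-(4 * eps α)) ≤ δ → (#(hits (d * α) γ δ (N / d)) : ℝ) ≤ 5 * δ * N / d := by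
  refine (isOfType_of_diophExponent_lt hα hL (lt_one_add _)).eventually_card_hits_le
    (by linarith [diophExponent_nonneg α]) (by linarith [eps_pos α]) ?_
  linarith [eps_mul_one_add_diophExponent α, eps_le α]

theorem eventually_le_card_hits (hα : Irrational α) (hL : ¬ Liouville α) :
    ∀ᶠ N : ℕ in atTop, ∀ γ δ : ℝ, (N : ℝ) ^ (-(4 * eps α)) ≤ δ → δ ≤ 1 →
      δ * N / 4 ≤ #(hits α γ δ N) := by
  refine (isOfType_of_diophExponent_lt hα hL (lt_one_add _)).eventually_le_card_hits
    (by linarith [diophExponent_nonneg α]) (by linarith [eps_pos α]) ?_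
  linarith [eps_mul_one_add_diophExponent α]

theorem eventually_card_Icc_sdiff_goodSet_le (hα : Irrational α) (hL : ¬ Liouville α) :
    ∀ᶠ N : ℕ in atTop, ∀ γ : ℝ,
      (#(Icc 1 N \ goodSet α γ N) : ℝ) ≤ 6 * (N : ℝ) ^ (-(2 * eps α)) * N := by
  filter_upwards [eventually_card_hits_le hα hL, eventually_gt_atTop 0] with N hhits hN γ
  have hN1 : (1 : ℝ) ≤ N := Nat.one_le_cast.2 hN
  have hsqrt : (N : ℝ) ^ (1 / 2 : ℝ) ≤ (N : ℝ) ^ (-(2 * eps α)) * N := by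
    rw [← Real.rpow_add_one (by positivity)]
    exact Real.rpow_le_rpow_of_exponent_le hN1 (by linarith [eps_le α])
  have hcard := hhits γ ((N : ℝ) ^ (-(2 * eps α))) 1 one_pos
    (by simpa using Real.one_le_rpow hN1 (eps_pos α).le)
    (Real.rpow_le_rpow_of_exponent_le hN1 (by linarith [eps_pos α]))
  simp only [Nat.cast_one, one_mul, Nat.div_one, div_one] at hcard
  linarith [card_Icc_sdiff_goodSet_le (α := α) (γ := γ) hN]

theorem eventually_le_card_filter_goodSet (hα : Irrational α) (hL : ¬ Liouville α) :
    ∀ᶠ N : ℕ in atTop, ∀ γ δ : ℝ, (N : ℝ) ^ (-eps α) ≤ δ → δ ≤ 1 →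
      δ * N / 8 ≤ #{n ∈ goodSet α γ N | distInt ((n : ℕ) * α - γ) ≤ δ} := by
  have hlim : Tendsto (fun N : ℕ => (N : ℝ) ^ eps α) atTop atTop :=
    (tendsto_rpow_atTop (eps_pos α)).comp tendsto_natCast_atTop_atTop
  filter_upwards [eventually_le_card_hits hα hL, eventually_card_Icc_sdiff_goodSet_le hα hL,
    hlim.eventually_ge_atTop 48, eventually_gt_atTop 0] with N hhits hbad hlarge hN γ δ hδ hδ1
  have hN1 : (1 : ℝ) ≤ N := Nat.one_le_cast.2 hN
  have hδ4 : (N : ℝ) ^ (-(4 * eps α)) ≤ δ :=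
    (Real.rpow_le_rpow_of_exponent_le hN1 (by linarith [eps_pos α])).trans hδ
  have hnegl : 48 * (N : ℝ) ^ (-(2 * eps α)) * N ≤ δ * N := by
    gcongr
    calc 48 * (N : ℝ) ^ (-(2 * eps α)) ≤ (N : ℝ) ^ eps α * (N : ℝ) ^ (-(2 * eps α)) := by gcongr
      _ = (N : ℝ) ^ (-eps α) := by
          rw [← Real.rpow_add (by positivity)]
          ring_nf
      _ ≤ δ := hδ
  have hsplit : (#(hits α γ δ N) : ℝ) ≤
      #{n ∈ goodSet α γ N | distInt ((n : ℕ) * α - γ) ≤ δ} + #(Icc 1 N \ goodSet α γ N) := by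
    exact_mod_cast card_hits_le_card_filter_goodSet_add α γ δ N
  linarith [hhits γ δ hδ4 hδ1, hbad γ]

theorem eventually_log_le_rpow_mul_log_two {e : ℝ} (he : 0 < e) :
    ∀ᶠ N : ℕ in atTop, Real.log N ≤ (N : ℝ) ^ e * Real.log 2 := by
  filter_upwards [((isLittleO_log_rpow_atTop he).comp_tendsto
    tendsto_natCast_atTop_atTop).bound (Real.log_pos one_lt_two)] with N hN
  rw [Function.comp_apply, Function.comp_apply, Real.norm_of_nonneg (Real.log_natCast_nonneg N),
    Real.norm_of_nonneg (by positivity)] at hN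
  rwa [mul_comm]

theorem eventually_le_sum_totient_div (hα : Irrational α) (hL : ¬ Liouville α) :
    ∀ᶠ N : ℕ in atTop, ∀ γ δ : ℝ, (N : ℝ) ^ (-eps α) ≤ δ → δ ≤ 1 →
      Real.exp (-162) / 8 * N * δ ≤
        ∑ n ∈ goodSet α γ N with distInt ((n : ℕ) * α - γ) ≤ δ, (n.totient : ℝ) / n := by
  filter_upwards [eventually_card_hits_le hα hL, eventually_le_card_filter_goodSet hα hL,
    eventually_log_le_rpow_mul_log_two (eps_pos α), eventually_gt_atTop 0]
    with N hhits hgood hlog hN γ δ hδ hδ1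
  have hN1 : (1 : ℝ) ≤ N := Nat.one_le_cast.2 hN
  have hδ4 : (N : ℝ) ^ (-(4 * eps α)) ≤ δ :=
    (Real.rpow_le_rpow_of_exponent_le hN1 (by linarith [eps_pos α])).trans hδ
  have hsub := filter_goodSet_subset_hits α γ δ N
  have hmem : ∀ n ∈ ({n ∈ goodSet α γ N | distInt ((n : ℕ) * α - γ) ≤ δ} : Finset ℕ),
      0 < n ∧ n ≤ N := fun n hn => (mem_hits.1 (hsub hn)).1
  have hdvd : ∀ d : ℕ, 0 < d → (d : ℝ) ≤ (N : ℝ) ^ eps α →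
      (#{n ∈ {n ∈ goodSet α γ N | distInt ((n : ℕ) * α - γ) ≤ δ} | d ∣ n} : ℝ) ≤
        40 * #{n ∈ goodSet α γ N | distInt ((n : ℕ) * α - γ) ≤ δ} / d := fun d hd hdN => by
    calc (#{n ∈ {n ∈ goodSet α γ N | distInt ((n : ℕ) * α - γ) ≤ δ} | d ∣ n} : ℝ)
        ≤ #(hits (d * α) γ δ (N / d)) := Nat.cast_le.2 <|
          (card_le_card (filter_subset_filter _ hsub)).trans (card_filter_dvd_hits_le α γ δ N hd)
      _ ≤ 5 * δ * N / d := hhits γ δ d hd hdN hδ4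
      _ ≤ _ := div_le_div_of_nonneg_right (by linarith [hgood γ δ hδ hδ1]) d.cast_nonneg
  calc Real.exp (-162) / 8 * N * δ = Real.exp (-(4 * 40 + 2)) * (δ * N / 8) := by
        rw [show (-(4 * 40 + 2) : ℝ) = -162 by norm_num]
        ring
    _ ≤ Real.exp (-(4 * 40 + 2)) * #{n ∈ goodSet α γ N | distInt ((n : ℕ) * α - γ) ≤ δ} := by
        gcongr
        exact hgood γ δ hδ hδ1
    _ ≤ _ := exp_mul_card_le_sum_totient_div (fun n hn => (hmem n hn).1.ne')
        (Real.one_le_rpow hN1 (eps_pos α).le) (fun n hn => (Real.log_le_log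
          (Nat.cast_pos.2 (hmem n hn).1) (Nat.cast_le.2 (hmem n hn).2)).trans hlog) hdvd

theorem eventually_T_le (hα : Irrational α) (hL : ¬ Liouville α) :
    ∀ᶠ N : ℕ in atTop, ∀ γ : ℝ, T α γ N ≤ 20 * (N * Real.log N) := by
  filter_upwards [eventually_card_hits_le hα hL, eventually_gt_atTop 0,
    (Real.tendsto_log_atTop.comp tendsto_natCast_atTop_atTop).eventually_ge_atTop 1]
    with N hhits hN hlog γ
  have hN1 : (1 : ℝ) ≤ N := Nat.one_le_cast.2 hN
  have heps := eps_pos α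
  have hcount : ∀ δ, (N : ℝ) ^ (-(4 * eps α)) ≤ δ → δ ≤ 1 →
      ∑ n ∈ goodSet α γ N with distInt ((n : ℕ) * α - γ) ≤ δ, (1 : ℝ) ≤ 5 * N * δ := by
    intro δ hδ _
    have hcard := hhits γ δ 1 one_pos (by simpa using Real.one_le_rpow hN1 heps.le) hδ
    simp only [Nat.cast_one, one_mul, Nat.div_one, div_one] at hcard
    rw [sum_const, nsmul_one, mul_right_comm]
    exact (Nat.cast_le.2 (card_le_card (filter_goodSet_subset_hits α γ δ N))).trans hcard
  calc T α γ N = ∑ n ∈ goodSet α γ N, 1 / distInt (n * α - γ) := rfl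
    _ ≤ 2 * (5 * N) * (1 + 2 * Real.log ((N : ℝ) ^ (-(4 * eps α)))⁻¹) :=
        sum_div_le_of_sum_filter_le (by positivity)
          (Real.rpow_le_one_of_one_le_of_nonpos hN1 (by linarith)) (fun _ _ => zero_le_one)
          (fun _ => rpow_neg_le_distInt_of_mem_goodSet) (fun _ _ => distInt_le_one _) hcount
    _ = 10 * N * (1 + 8 * eps α * Real.log N) := by
        rw [← Real.rpow_neg (by positivity), neg_neg, Real.log_rpow (by positivity)]
        ring
    _ ≤ 10 * N * (Real.log N + 1 * Real.log N) := by
        gcongr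
        · exact hlog
        · linarith [eps_le α]
    _ = 20 * (N * Real.log N) := by ring

theorem eventually_le_TStar (hα : Irrational α) (hL : ¬ Liouville α) :
    ∀ᶠ N : ℕ in atTop, ∀ γ : ℝ,
      eps α * Real.exp (-162) / 16 * (N * Real.log N) ≤ TStar α γ N := by
  filter_upwards [eventually_le_sum_totient_div hα hL, eventually_gt_atTop 0] with N hsum hN γ
  have hN1 : (1 : ℝ) ≤ N := Nat.one_le_cast.2 hN
  calc eps α * Real.exp (-162) / 16 * (N * Real.log N)
      = Real.exp (-162) / 8 * N / 2 * Real.log ((N : ℝ) ^ (-eps α))⁻¹ := by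
        rw [← Real.rpow_neg (by positivity), neg_neg, Real.log_rpow (by positivity)]
        ring
    _ ≤ ∑ n ∈ goodSet α γ N, (n.totient : ℝ) / n / distInt (n * α - γ) :=
        le_sum_div_of_le_sum_filter (by positivity)
          (Real.rpow_le_one_of_one_le_of_nonpos hN1 (by linarith [eps_pos α]))
          (fun _ _ => by positivity) (fun _ => distInt_pos_of_mem_goodSet) (by positivity)
          (hsum γ)
    _ = TStar α γ N := by
        simp only [div_div]
        rfl

end Asymptotics

end FracSums

theorem mainTheorem6 (α : ℝ) (hirr : Irrational α) (hL : ¬ Liouville α) :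
    ∃ c C : ℝ, 0 < c ∧ 0 < C ∧ ∃ N₀ : ℕ, ∀ γ : ℝ, ∀ N : ℕ, N₀ ≤ N →
      -- `T_N ≍ N log N`
      (c * (N * Real.log N) ≤ FracSums.T α γ N ∧ FracSums.T α γ N ≤ C * (N * Real.log N)) ∧
      -- `T*_N ≍ N log N`
      (c * (N * Real.log N) ≤ FracSums.TStar α γ N ∧
        FracSums.TStar α γ N ≤ C * (N * Real.log N)) ∧
      -- `T_N ≍ T*_N`
      (c * FracSums.TStar α γ N ≤ FracSums.T α γ N ∧
        FracSums.T α γ N ≤ C * FracSums.TStar α γ N) := by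
  set c := FracSums.eps α * Real.exp (-162) / 16 with hc
  have hc0 : 0 < c := by have := FracSums.eps_pos α; positivity
  have hc1 : c ≤ 1 := by
    have := Real.exp_le_one_iff.2 (by norm_num : (-162 : ℝ) ≤ 0)
    nlinarith [FracSums.eps_le α, FracSums.eps_pos α]
  obtain ⟨N₀, hN₀⟩ := Filter.eventually_atTop.1
    ((FracSums.eventually_T_le hirr hL).and (FracSums.eventually_le_TStar hirr hL))
  refine ⟨c, 20 / c, hc0, by positivity, N₀, fun γ N hN => ?_⟩
  have hT : FracSums.T α γ N ≤ 20 * (N * Real.log N) := (hN₀ N hN).1 γ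
  have hTStar : c * (N * Real.log N) ≤ FracSums.TStar α γ N := (hN₀ N hN).2 γ
  have hle := FracSums.TStar_le_T α γ N
  have hlog := mul_nonneg (N.cast_nonneg (α := ℝ)) (Real.log_natCast_nonneg N)
  have hT' : FracSums.T α γ N ≤ 20 / c * (N * Real.log N) :=
    hT.trans (mul_le_mul_of_nonneg_right (le_div_self (by norm_num) hc0 hc1) hlog)
  have hTT : FracSums.T α γ N ≤ 20 / c * FracSums.TStar α γ N := by
    calc FracSums.T α γ N ≤ 20 / c * (c * (N * Real.log N)) := by
          rwa [← mul_assoc, div_mul_cancel₀ _ hc0.ne']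
      _ ≤ 20 / c * FracSums.TStar α γ N := by gcongr
  exact ⟨⟨hTStar.trans hle, hT'⟩, ⟨hTStar, hle.trans hT'⟩,
    (mul_le_of_le_one_left ((mul_nonneg hc0.le hlog).trans hTStar) hc1).trans hle, hTT⟩
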